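/- **Setting.** Let $m,n\ge 1$. A bipartite state is a density matrix $\rho$ (positive semidefinite, trace one) on $\mathcal H_A\otimes\mathcal H_B=\mathbb C^m\otimes\mathbb C^n$. For a density matrix $\varrho$ on a finite-dimensional space, its total entropy is $$S^t(\varrho)=-\mathrm{Tr}\big[\varrho\log_2\varrho+(\mathbb 1-\varrho)\log_2(\mathbb 1-\varrho)\big],\qquad 0\log_2 0:=0 .$$ Fix an integer $d\ge 2$ and put $r=d\log_2 d-(d-1)\log_2(d-1)>0$ (for $d\times d$ systems one takes this same $d$, so that the maximal value of $S^t$ on $\mathbb C^d$ is $r$). For a unit vector $|\Phi\rangle\in\mathbb C^m\otimes\mathbb C^n$ let $$E_t(|\Phi\rangle)=\tfrac1r\,S^t(\varrho_A),\qquad \varrho_A=\mathrm{Tr}_B|\Phi\rangle\langle\Phi| ,$$ and for an arbitrary bipartite state $\rho$ let $$E_t(\rho)=\inf_{\{p_i,|\Phi_i\rangle\}}\sum_i p_iE_t(|\Phi_i\rangle),$$ the infimum being over all finite decompositions $\rho=\sum_ip_i|\Phi_i\rangle\langle\Phi_i|$ into unit vectors with $p_i\ge 0$ and $\sum_ip_i=1$.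 An LOCC protocol consists of finitely many rounds. In each round one of the two parties performs a generalized measurement on its own system, with finitely many Kraus operators $K_i$ such that $\sum_iK_i^\dagger K_i=\mathbb 1$ (the dimension of its system may change), and announces the result; the choice of each round may depend on all earlier results. At the end an outcome $j$ from a finite set is declared as a function of all results. The completely positive map $\Lambda_j$ is the sum of the maps performed along all histories that lead to the outcome $j$. **Theorem.** $E_t$ is a bipartite entanglement measure: it takes values $E_t(\rho)\ge 0$, and for all local dimensions * (E1) $E_t(\rho)=0$ if and only if $\rho$ is separable, that is, $\rho=\sum_ip_i\,\alpha_i\otimes\beta_i$ for a finite probability distribution $\{p_i\}$ and density matrices $\alpha_i$ on $\mathbb C^m$ and $\beta_i$ on $\mathbb C^n$; * (E2) $E_t\big((U_A\otimes U_B)\rho(U_A^\dagger\otimes U_B^\dagger)\big)=E_t(\rho)$ for all unitaries $U_A$ on $\mathbb C^m$ and $U_B$ on $\mathbb C^n$; * (E3) for every LOCC protocol from $\mathbb C^m\otimes\mathbb C^n$ to $\mathbb C^{m_1}\otimes\mathbb C^{n_1}$ (in particular with $m_1=m$, $n_1=n$) with outcome maps $\Lambda_j$, and every state $\rho$: if $\Lambda_j(\rho)=p_j\sigma_j$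 with states $\sigma_j$, then $\sum_jp_jE_t(\sigma_j)\le E_t(\rho)$, where $d$ is the same on both sides; * (E4) $E_t\big(\sum_ip_i\rho_i\big)\le\sum_ip_iE_t(\rho_i)$ for every finite probability distribution $\{p_i\}$ and all states $\rho_i$ on $\mathbb C^m\otimes\mathbb C^n$. -/

import Mathlib

open scoped Matrix Kronecker BigOperators ComplexOrder

noncomputable section

namespace TotalEntropy

/-- Density matrices on the Hilbert space `ℂ^ι`: positive semidefinite with unit trace. -/
def DensityMatrix (ι : Type) [Fintype ι] : Type :=
  {ρ : Matrix ι ι ℂ // ρ.PosSemidef ∧ ρ.trace = 1}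

/-- States of a bipartite system on `ℂ^m ⊗ ℂ^n`. -/
abbrev BipartiteState (m n : ℕ) : Type := DensityMatrix (Fin m × Fin n)

/-- Unit vectors of `ℂ^m ⊗ ℂ^n`, given by their coordinates in the product basis. -/
def PureState (m n : ℕ) : Type :=
  {ψ : Fin m × Fin n → ℂ // ∑ x, ‖ψ x‖ ^ 2 = 1}

/-- The projector `|ψ⟩⟨ψ|`. -/
def PureState.proj {m n : ℕ} (ψ : PureState m n) :
    Matrix (Fin m × Fin n) (Fin m × Fin n) ℂ :=
  Matrix.vecMulVec ψ.1 (star ψ.1)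

/-- The partial trace over the second tensor factor. -/
def partialTraceB {m n : ℕ} (M : Matrix (Fin m × Fin n) (Fin m × Fin n) ℂ) :
    Matrix (Fin m) (Fin m) ℂ :=
  Matrix.of fun i k => ∑ j, M (i, j) (k, j)

/-- The logarithm to base two of a Hermitian matrix, through the functional calculus
(on the kernel it is set to zero, that is, `0 log 0 = 0` in the entropy below). -/
def matLogTwo {m : ℕ} (M : Matrix (Fin m) (Fin m) ℂ) : Matrix (Fin m) (Fin m) ℂ :=
  cfc (Real.logb 2) M

/-- The total entropy `S^t(ρ) = - Tr [ρ log₂ ρ + (1 - ρ) log₂ (1 - ρ)]`. -/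
def totalEntropy {m : ℕ} (ρ : Matrix (Fin m) (Fin m) ℂ) : ℝ :=
  -(Matrix.trace (ρ * matLogTwo ρ + (1 - ρ) * matLogTwo (1 - ρ))).re

/-- The normalization factor `r = d log₂ d - (d - 1) log₂ (d - 1)`. -/
def normFactor (d : ℕ) : ℝ :=
  (d : ℝ) * Real.logb 2 d - ((d : ℝ) - 1) * Real.logb 2 ((d : ℝ) - 1)

/-- The entropy entanglement `S^t(ρ_A) / r` of a pure state. The dimension `d` that fixes the
normalization is a parameter of its own, so that unequal local dimensions, and operations that
change them, make sense; for `ℂ^d ⊗ ℂ^d` the usual choice is this same `d`. -/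
def pureEntanglement (d : ℕ) {m n : ℕ} (ψ : PureState m n) : ℝ :=
  1 / normFactor d * totalEntropy (partialTraceB ψ.proj)

/-- `p` is a probability distribution on `k` points. -/
def IsProb {k : ℕ} (p : Fin k → ℝ) : Prop := (∀ i, 0 ≤ p i) ∧ ∑ i, p i = 1

/-- The entropy entanglement `E_t` of a bipartite state: the convex roof of its values on pure
states, over all finite pure-state decompositions `ρ = ∑ i, p i |ψ i⟩⟨ψ i|`. -/
def entanglement (d m n : ℕ) (ρ : BipartiteState m n) : ℝ :=
  sInf {x : ℝ | ∃ (k : ℕ) (p : Fin k → ℝ) (ψ : Fin k → PureState m n),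
    IsProb p ∧ ρ.1 = ∑ i, p i • (ψ i).proj ∧ x = ∑ i, p i * pureEntanglement d (ψ i)}

/-- Separable states: finite convex combinations of product states. -/
def IsSeparable {m n : ℕ} (ρ : BipartiteState m n) : Prop :=
  ∃ (k : ℕ) (p : Fin k → ℝ) (α : Fin k → DensityMatrix (Fin m))
    (β : Fin k → DensityMatrix (Fin n)),
    IsProb p ∧ ρ.1 = ∑ i, p i • ((α i).1 ⊗ₖ (β i).1)

/-- LOCC protocols from `ℂ^m ⊗ ℂ^n` (the two last indices) to `ℂ^m₁ ⊗ ℂ^n₁`, with outcomes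
in `J`. A protocol is a finite tree. At each inner node one of the two parties performs a
generalized measurement on its own system, with Kraus operators `K i` (its local dimension may
change), and announces the result `i`; the rest of the protocol may depend on `i`. A leaf ends
the protocol and declares an outcome `j`. Several leaves may declare the same outcome, which
covers any discarding of information. -/
inductive LOCC (J : Type) (m₁ n₁ : ℕ) : ℕ → ℕ → Type
  | done (j : J) : LOCC J m₁ n₁ m₁ n₁
  | alice {m n k : ℕ} (c : Fin k → ℕ) (K : ∀ i, Matrix (Fin (c i)) (Fin m) ℂ)
      (hK : ∑ i, (K i)ᴴ * K i = 1) (next : ∀ i, LOCC J m₁ n₁ (c i) n) : LOCC J m₁ n₁ m n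
  | bob {m n k : ℕ} (c : Fin k → ℕ) (K : ∀ i, Matrix (Fin (c i)) (Fin n) ℂ)
      (hK : ∑ i, (K i)ᴴ * K i = 1) (next : ∀ i, LOCC J m₁ n₁ m (c i)) : LOCC J m₁ n₁ m n

/-- The completely positive map `Λ_j` that a protocol performs when its outcome is `j`. Applied
to a state it gives the unnormalized state after that outcome, and its trace is the probability
of the outcome. -/
def LOCC.branch {J : Type} [DecidableEq J] {m₁ n₁ : ℕ} :
    {m n : ℕ} → LOCC J m₁ n₁ m n → J → Matrix (Fin m × Fin n) (Fin m × Fin n) ℂ →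
      Matrix (Fin m₁ × Fin n₁) (Fin m₁ × Fin n₁) ℂ
  | _, _, .done l, j, M => if l = j then M else 0
  | _, n, .alice _ K _ next, j, M =>
      ∑ i, (next i).branch j
        ((K i ⊗ₖ (1 : Matrix (Fin n) (Fin n) ℂ)) * M *
          (K i ⊗ₖ (1 : Matrix (Fin n) (Fin n) ℂ))ᴴ)
  | m, _, .bob _ K _ next, j, M =>
      ∑ i, (next i).branch j
        (((1 : Matrix (Fin m) (Fin m) ℂ) ⊗ₖ K i) * M *
          ((1 : Matrix (Fin m) (Fin m) ℂ) ⊗ₖ K i)ᴴ)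

/-- Bipartite entanglement measures: nonnegative functions of bipartite states that satisfy
(E1) faithfulness, (E2) invariance under local unitaries, (E3) monotonicity on average under LOCC
and (E4) convexity. -/
structure IsEntanglementMeasure (E : ∀ m n : ℕ, BipartiteState m n → ℝ) : Prop where
  nonneg : ∀ (m n : ℕ) (ρ : BipartiteState m n), 0 ≤ E m n ρ
  eq_zero_iff : ∀ (m n : ℕ) (ρ : BipartiteState m n), E m n ρ = 0 ↔ IsSeparable ρ
  local_unitary : ∀ (m n : ℕ) (ρ σ : BipartiteState m n),
    ∀ U ∈ Matrix.unitaryGroup (Fin m) ℂ, ∀ V ∈ Matrix.unitaryGroup (Fin n) ℂ,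
      σ.1 = (U ⊗ₖ V) * ρ.1 * (Uᴴ ⊗ₖ Vᴴ) → E m n σ = E m n ρ
  locc : ∀ (m n m₁ n₁ q : ℕ) (P : LOCC (Fin q) m₁ n₁ m n) (ρ : BipartiteState m n)
    (p : Fin q → ℝ) (σ : Fin q → BipartiteState m₁ n₁),
      (∀ j, P.branch j ρ.1 = p j • (σ j).1) → ∑ j, p j * E m₁ n₁ (σ j) ≤ E m n ρ
  convex : ∀ (m n k : ℕ) (p : Fin k → ℝ) (ρ : Fin k → BipartiteState m n)
    (σ : BipartiteState m n),
      IsProb p → σ.1 = ∑ i, p i • (ρ i).1 → E m n σ ≤ ∑ i, p i * E m n (ρ i)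

end TotalEntropy

end

/-! Write a bipartite vector as its coefficient matrix `X`. Its reduced state is `X * Xᴴ`, and its
entanglement is `Tr f(X * Xᴴ)` with `f` a positive multiple of the binary entropy: concave and
nonnegative on `[0, 1]`, zero at both ends. Concavity of `f` makes `Tr f` concave on density
matrices (`sum_mul_spectralSum_le`), so its homogeneous extension `scaledSum` is superadditive
(`sum_scaledSum_le`). The pairs (mixture, total value) form an additive submonoid `ensembles`, and
`E_t(ρ)` is the infimum of the values lying over `ρ` (`exists_decomposition_iff`). Convexity follows
because mixtures of ensembles are ensembles. A local measurement sends each vector to several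
vectors of no larger total value, by superadditivity applied to the reduced state of the other
party; induction over the protocol tree gives (E3), and (E2) is (E3) for a unitary and its inverse.
For (E1), product vectors have rank one reductions, on which `Tr f` vanishes. Conversely `f`
dominates a multiple of `x (1 - x)`, so entanglement dominates a multiple of `minorDefect`, a
continuous function that vanishes exactly on product vectors. If `E_t(ρ) = 0`, compactness of the
convex hull of the graph of `minorDefect` turns an infimum into an attained decomposition of defect
zero, which consists of product vectors. -/

open scoped Matrix Kronecker BigOperators ComplexOrder

noncomputable section

namespace TotalEntropy

open Matrix

/-! ### Trace functions of Hermitian matrices and their concavity. -/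

section SpectralSum

variable {ι κ : Type} [Fintype ι] [DecidableEq ι] [Fintype κ] [DecidableEq κ]

/-- The trace of a function of a Hermitian matrix. -/
def spectralSum (f : ℝ → ℝ) (A : Matrix ι ι ℂ) : ℝ := (trace (cfc f A)).re

theorem spectralSum_eq_sum_eigenvalues (f : ℝ → ℝ) {A : Matrix ι ι ℂ} (hA : A.IsHermitian) :
    spectralSum f A = ∑ i, f (hA.eigenvalues i) := by
  rw [spectralSum, hA.cfc_eq, IsHermitian.cfc, Unitary.conjStarAlgAut_apply, trace_mul_comm,
    ← mul_assoc]
  simp [trace]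

/-- The spectrum is finite, so even the logarithm at `0` meets the continuity conditions of the
functional calculus. -/
theorem continuousOn_spectrum (f : ℝ → ℝ) (A : Matrix ι ι ℂ) : ContinuousOn f (spectrum ℝ A) :=
  A.finite_real_spectrum.continuousOn f

theorem totalEntropy_eq_spectralSum {m : ℕ} {A : Matrix (Fin m) (Fin m) ℂ} (hA : A.IsHermitian) :
    totalEntropy A = spectralSum (fun x => Real.binEntropy x / Real.log 2) A := by
  have hA' : IsSelfAdjoint A := hA
  have h1 : A * matLogTwo A = cfc (fun x => x * Real.logb 2 x) A := by
    rw [matLogTwo, cfc_mul (fun x : ℝ => x) _ A (continuousOn_spectrum _ _)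
      (continuousOn_spectrum _ _), cfc_id' ℝ A]
  have h2 : (1 : Matrix (Fin m) (Fin m) ℂ) - A = cfc (fun x : ℝ => 1 - x) A := by
    rw [cfc_sub _ _ A (continuousOn_spectrum _ _) (continuousOn_spectrum _ _), cfc_id' ℝ A,
      cfc_const_one ℝ A]
  have h3 : (1 - A) * matLogTwo (1 - A) = cfc (fun x => (1 - x) * Real.logb 2 (1 - x)) A := by
    rw [cfc_mul (fun x : ℝ => 1 - x) _ A (continuousOn_spectrum _ _)
      (continuousOn_spectrum _ _), ← h2, matLogTwo]
    congr 1
    conv_lhs => rw [h2]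
    rw [← cfc_comp' (Real.logb 2) (fun x : ℝ => 1 - x) A
      ((A.finite_real_spectrum.image _).continuousOn _) (continuousOn_spectrum _ _)]
  rw [totalEntropy, trace_add, h1, h3, Complex.add_re]
  change -(spectralSum _ A + spectralSum _ A) = _
  simp only [spectralSum_eq_sum_eigenvalues _ hA]
  rw [← Finset.sum_add_distrib, ← Finset.sum_neg_distrib]
  refine Finset.sum_congr rfl fun i _ => ?_
  rw [Real.binEntropy, Real.log_inv, Real.log_inv, Real.logb, Real.logb]
  ring

/-- The two spectra differ only in the multiplicity of `0`, where `f` contributes nothing. -/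
theorem spectralSum_eq_of_charpoly_mul {f : ℝ → ℝ} (hf : f 0 = 0) {A : Matrix ι ι ℂ}
    {B : Matrix κ κ ℂ} (hA : A.IsHermitian) (hB : B.IsHermitian)
    (h : (Polynomial.X : Polynomial ℂ) ^ Fintype.card κ * A.charpoly =
      Polynomial.X ^ Fintype.card ι * B.charpoly) :
    spectralSum f A = spectralSum f B := by
  have h' := congrArg (fun p => (p.roots.map fun z : ℂ => f z.re).sum) h
  rw [Polynomial.roots_mul (mul_ne_zero (by simp) A.charpoly_monic.ne_zero),
    Polynomial.roots_mul (mul_ne_zero (by simp) B.charpoly_monic.ne_zero),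
    hA.roots_charpoly_eq_eigenvalues, hB.roots_charpoly_eq_eigenvalues] at h'
  simpa [hf, spectralSum_eq_sum_eigenvalues f hA, spectralSum_eq_sum_eigenvalues f hB,
    Multiset.map_nsmul, Function.comp_def, Multiset.sum_nsmul] using h'

theorem spectralSum_mul_conjTranspose_comm {f : ℝ → ℝ} (hf : f 0 = 0) (t : ℝ)
    (X : Matrix ι κ ℂ) :
    spectralSum f (t • (X * Xᴴ)) = spectralSum f (t • (Xᴴ * X)) := by
  have hs : ∀ {α : Type} [Fintype α] {A : Matrix α α ℂ}, A.IsHermitian →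
      (t • A).IsHermitian := fun hA => by
    rw [IsHermitian, conjTranspose_smul, hA.eq, star_trivial]
  refine spectralSum_eq_of_charpoly_mul hf (hs (isHermitian_mul_conjTranspose_self X))
    (hs (isHermitian_conjTranspose_mul_self X)) ?_
  have := charpoly_mul_comm' (t • X) Xᴴ
  simpa using this

theorem eigenvalues_mem_Icc {A : Matrix ι ι ℂ} (hA : A.PosSemidef) (ht : A.trace = 1) (i : ι) :
    hA.isHermitian.eigenvalues i ∈ Set.Icc (0 : ℝ) 1 := by
  refine ⟨hA.eigenvalues_nonneg i, ?_⟩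
  have h : ∑ j, hA.isHermitian.eigenvalues j = 1 := by
    have := hA.isHermitian.trace_eq_sum_eigenvalues
    rw [ht, ← RCLike.ofReal_sum] at this
    exact (RCLike.ofReal_injective (K := ℂ) (by simpa using this.symm))
  rw [← h]
  exact Finset.single_le_sum (f := hA.isHermitian.eigenvalues)
    (fun j _ => hA.eigenvalues_nonneg j) (Finset.mem_univ i)

theorem spectralSum_mono {f g : ℝ → ℝ} (hfg : ∀ x ∈ Set.Icc (0 : ℝ) 1, f x ≤ g x)
    {A : Matrix ι ι ℂ} (hA : A.PosSemidef) (ht : A.trace = 1) :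
    spectralSum f A ≤ spectralSum g A := by
  simp only [spectralSum_eq_sum_eigenvalues _ hA.isHermitian]
  exact Finset.sum_le_sum fun i _ => hfg _ (eigenvalues_mem_Icc hA ht i)

/-- The diagonal of `Uᴴ A U` is obtained from the eigenvalues of `A` by an averaging. -/
theorem diag_conj_eq_sum_eigenvalues {A : Matrix ι ι ℂ} (hA : A.IsHermitian) (U : Matrix ι ι ℂ)
    (k : ι) : ((Uᴴ * A * U) k k).re =
      ∑ l, ‖((hA.eigenvectorUnitary : Matrix ι ι ℂ)ᴴ * U) l k‖ ^ 2 * hA.eigenvalues l := by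
  set V : Matrix ι ι ℂ := hA.eigenvectorUnitary.1 with hV
  have h : Uᴴ * A * U = (Vᴴ * U)ᴴ * diagonal (RCLike.ofReal ∘ hA.eigenvalues) * (Vᴴ * U) := by
    conv_lhs => rw [hA.spectral_theorem, Unitary.conjStarAlgAut_apply, ← hV]
    rw [conjTranspose_mul, conjTranspose_conjTranspose]
    simp only [star_eq_conjTranspose, mul_assoc]
  rw [h, mul_apply, Complex.re_sum]
  refine Finset.sum_congr rfl fun l _ => ?_
  rw [mul_diagonal, conjTranspose_apply]
  simp only [Function.comp_apply, Complex.coe_algebraMap, RCLike.star_def]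
  rw [mul_right_comm, ← Complex.normSq_eq_conj_mul_self, Complex.normSq_eq_norm_sq,
    ← Complex.ofReal_mul, Complex.ofReal_re]

theorem sum_norm_sq_col_of_unitary {W : Matrix ι ι ℂ} (hW : Wᴴ * W = 1) (k : ι) :
    ∑ l, ‖W l k‖ ^ 2 = 1 := by
  have h := congrFun (congrFun hW k) k
  rw [mul_apply, one_apply_eq] at h
  have h' : ((∑ l, ‖W l k‖ ^ 2 : ℝ) : ℂ) = 1 := by
    rw [← h]
    push_cast
    refine Finset.sum_congr rfl fun l _ => ?_
    rw [conjTranspose_apply, RCLike.star_def, Complex.conj_mul']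
  exact_mod_cast h'

theorem diag_conj_mem_Icc {A : Matrix ι ι ℂ} (hA : A.PosSemidef) (ht : A.trace = 1)
    {U : Matrix ι ι ℂ} (hU : U ∈ unitaryGroup ι ℂ) (k : ι) :
    ((Uᴴ * A * U) k k).re ∈ Set.Icc (0 : ℝ) 1 := by
  rw [diag_conj_eq_sum_eigenvalues hA.isHermitian]
  have hW := mul_mem (star hA.isHermitian.eigenvectorUnitary).2 hU
  exact (convex_Icc (0 : ℝ) 1).sum_mem (fun _ _ => sq_nonneg _)
    (sum_norm_sq_col_of_unitary (mem_unitaryGroup_iff'.1 hW) k)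
    fun l _ => eigenvalues_mem_Icc hA ht l

/-- The Peierls inequality for concave functions. -/
theorem spectralSum_le_sum_diag {f : ℝ → ℝ} (hf : ConcaveOn ℝ (Set.Icc 0 1) f)
    {A : Matrix ι ι ℂ} (hA : A.PosSemidef) (ht : A.trace = 1)
    {U : Matrix ι ι ℂ} (hU : U ∈ unitaryGroup ι ℂ) :
    spectralSum f A ≤ ∑ k, f ((Uᴴ * A * U) k k).re := by
  have hW := mul_mem (star hA.isHermitian.eigenvectorUnitary).2 hU
  set W : Matrix ι ι ℂ := star (hA.isHermitian.eigenvectorUnitary : Matrix ι ι ℂ) * U with hWdef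
  -- Unit rows give total weight one to each eigenvalue; unit columns, used below, are what Jensen's
  -- inequality needs.
  have hrow : ∀ l, ∑ k, ‖W l k‖ ^ 2 = 1 := fun l => by
    have := sum_norm_sq_col_of_unitary (W := Wᴴ)
      (by rw [conjTranspose_conjTranspose]; exact mem_unitaryGroup_iff.1 hW) l
    simpa using this
  calc spectralSum f A
      = ∑ l, ∑ k, ‖W l k‖ ^ 2 * f (hA.isHermitian.eigenvalues l) := by
        rw [spectralSum_eq_sum_eigenvalues f hA.isHermitian]
        refine Finset.sum_congr rfl fun l _ => ?_
        rw [← Finset.sum_mul, hrow, one_mul]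
    _ = ∑ k, ∑ l, ‖W l k‖ ^ 2 * f (hA.isHermitian.eigenvalues l) := Finset.sum_comm
    _ ≤ ∑ k, f ((Uᴴ * A * U) k k).re := by
        refine Finset.sum_le_sum fun k _ => ?_
        rw [diag_conj_eq_sum_eigenvalues hA.isHermitian]
        exact hf.le_map_sum (fun _ _ => sq_nonneg _)
          (sum_norm_sq_col_of_unitary (mem_unitaryGroup_iff'.1 hW) k)
          fun l _ => eigenvalues_mem_Icc hA ht l

/-- Concavity of the trace of a concave function on density matrices. -/
theorem sum_mul_spectralSum_le {f : ℝ → ℝ} (hf : ConcaveOn ℝ (Set.Icc 0 1) f)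
    {α : Type} (s : Finset α) {p : α → ℝ} (hp : ∀ a ∈ s, 0 ≤ p a) (hp1 : ∑ a ∈ s, p a = 1)
    {B : α → Matrix ι ι ℂ} (hB : ∀ a ∈ s, (B a).PosSemidef) (ht : ∀ a ∈ s, (B a).trace = 1)
    {A : Matrix ι ι ℂ} (hA : A.IsHermitian) (h : A = ∑ a ∈ s, p a • B a) :
    ∑ a ∈ s, p a * spectralSum f (B a) ≤ spectralSum f A := by
  -- In an eigenbasis of `A` its diagonal lists its eigenvalues. Peierls bounds each `B a` by its
  -- diagonal there, and Jensen's inequality compares the diagonals entry by entry.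
  set U : Matrix ι ι ℂ := hA.eigenvectorUnitary.1 with hU
  have hUm : U ∈ unitaryGroup ι ℂ := hA.eigenvectorUnitary.2
  have hdiag : ∀ k, hA.eigenvalues k = ∑ a ∈ s, p a * ((Uᴴ * B a * U) k k).re := fun k => by
    have h1 : ((Uᴴ * A * U) k k).re = hA.eigenvalues k := by
      have := hA.conjStarAlgAut_star_eigenvectorUnitary
      rw [Unitary.conjStarAlgAut_star_apply] at this
      change (((star hA.eigenvectorUnitary.1) * A * hA.eigenvectorUnitary.1) k k).re = _
      rw [this]
      simp
    rw [← h1, h, Finset.mul_sum, Finset.sum_mul, Matrix.sum_apply, Complex.re_sum]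
    refine Finset.sum_congr rfl fun a _ => ?_
    rw [mul_smul_comm, smul_mul_assoc, Matrix.smul_apply, Complex.real_smul, Complex.re_ofReal_mul]
  calc ∑ a ∈ s, p a * spectralSum f (B a)
      ≤ ∑ a ∈ s, p a * ∑ k, f ((Uᴴ * B a * U) k k).re :=
        Finset.sum_le_sum fun a ha => mul_le_mul_of_nonneg_left
          (spectralSum_le_sum_diag hf (hB a ha) (ht a ha) hUm) (hp a ha)
    _ = ∑ k, ∑ a ∈ s, p a * f ((Uᴴ * B a * U) k k).re := by
        simp only [Finset.mul_sum]
        exact Finset.sum_comm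
    _ ≤ spectralSum f A := by
        rw [spectralSum_eq_sum_eigenvalues f hA]
        refine Finset.sum_le_sum fun k _ => ?_
        rw [hdiag k]
        exact hf.le_map_sum hp hp1 fun a ha => diag_conj_mem_Icc (hB a ha) (ht a ha) hUm k

theorem spectralSum_eq_zero_of_idempotent {f : ℝ → ℝ} (h0 : f 0 = 0) (h1 : f 1 = 0)
    {A : Matrix ι ι ℂ} (hA : A.IsHermitian) (hi : IsIdempotentElem A) : spectralSum f A = 0 := by
  rw [spectralSum_eq_sum_eigenvalues f hA]
  refine Finset.sum_eq_zero fun i _ => ?_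
  rcases IsIdempotentElem.spectrum_subset ℝ hi (hA.eigenvalues_mem_spectrum_real i) with h | h
  · rw [h, h0]
  · rw [Set.mem_singleton_iff.1 h, h1]

theorem spectralSum_mul_one_sub {A : Matrix ι ι ℂ} (hA : A.IsHermitian) :
    spectralSum (fun x => x * (1 - x)) A = (trace (A * (1 - A))).re := by
  have hA' : IsSelfAdjoint A := hA
  rw [spectralSum, cfc_mul (fun x : ℝ => x) _ A (continuousOn_spectrum _ _)
    (continuousOn_spectrum _ _), cfc_sub _ _ A (continuousOn_spectrum _ _)
    (continuousOn_spectrum _ _), cfc_id' ℝ A, cfc_const_one ℝ A]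

theorem spectralSum_const_mul (c : ℝ) (f : ℝ → ℝ) {A : Matrix ι ι ℂ} (hA : A.IsHermitian) :
    spectralSum (fun x => c * f x) A = c * spectralSum f A := by
  simp only [spectralSum_eq_sum_eigenvalues _ hA, Finset.mul_sum]

end SpectralSum

end TotalEntropy

namespace TotalEntropy

open Matrix

/-! ### The homogeneous extension and its monotonicity under local measurements. -/

section ScaledSum

variable {ι κ : Type} [Fintype ι] [Fintype κ]

theorem ofReal_trace_re {M : Matrix ι ι ℂ} (hM : M.PosSemidef) : (M.trace.re : ℂ) = M.trace :=
  (Complex.eq_re_of_ofReal_le (r := 0) (by simpa using hM.trace_nonneg)).symm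

theorem trace_re_nonneg {M : Matrix ι ι ℂ} (hM : M.PosSemidef) : 0 ≤ M.trace.re :=
  (Complex.nonneg_iff.1 hM.trace_nonneg).1

theorem eq_zero_of_trace_re_eq_zero {M : Matrix ι ι ℂ} (hM : M.PosSemidef)
    (h : M.trace.re = 0) : M = 0 := by
  rw [← hM.trace_eq_zero_iff, ← ofReal_trace_re hM, h, Complex.ofReal_zero]

theorem posSemidef_real_smul {α : Type} {M : Matrix α α ℂ} (hM : M.PosSemidef) {c : ℝ} (hc : 0 ≤ c) :
    (c • M).PosSemidef := by
  rw [← Complex.coe_smul]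
  exact hM.smul (by exact_mod_cast hc)

theorem trace_normalized {M : Matrix ι ι ℂ} (hM : M.PosSemidef) (h : M.trace.re ≠ 0) :
    (M.trace.re⁻¹ • M).trace = 1 := by
  have h' : M.trace ≠ 0 := fun h0 => h (by rw [h0, Complex.zero_re])
  rw [trace_smul, Complex.real_smul, Complex.ofReal_inv, ofReal_trace_re hM, inv_mul_cancel₀ h']

variable [DecidableEq ι] [DecidableEq κ]

/-- The positively homogeneous extension of `spectralSum f` from density matrices to positive
semidefinite matrices. -/
def scaledSum (f : ℝ → ℝ) (M : Matrix ι ι ℂ) : ℝ :=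
  M.trace.re * spectralSum f (M.trace.re⁻¹ • M)

theorem scaledSum_nonneg {f : ℝ → ℝ} (hf : ∀ x ∈ Set.Icc (0 : ℝ) 1, 0 ≤ f x)
    {M : Matrix ι ι ℂ} (hM : M.PosSemidef) : 0 ≤ scaledSum f M := by
  by_cases h : M.trace.re = 0
  · rw [scaledSum, h, zero_mul]
  · have hN := posSemidef_real_smul hM (inv_nonneg.2 (trace_re_nonneg hM))
    rw [scaledSum, spectralSum_eq_sum_eigenvalues f hN.isHermitian]
    exact mul_nonneg (trace_re_nonneg hM) (Finset.sum_nonneg fun i _ =>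
      hf _ (eigenvalues_mem_Icc hN (trace_normalized hM h) i))

theorem scaledSum_smul (f : ℝ → ℝ) (c : ℝ) (M : Matrix ι ι ℂ) :
    scaledSum f (c • M) = c * scaledSum f M := by
  by_cases hc : c = 0
  · simp [scaledSum, hc]
  · have h : (c • M).trace.re = c * M.trace.re := by
      rw [trace_smul, Complex.real_smul, Complex.re_ofReal_mul]
    have h' : (c * M.trace.re)⁻¹ * c = M.trace.re⁻¹ := by
      rw [_root_.mul_inv_rev, mul_assoc, inv_mul_cancel₀ hc, mul_one]
    rw [scaledSum, scaledSum, h, smul_smul, h', mul_assoc]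

theorem scaledSum_of_trace_eq_one (f : ℝ → ℝ) {M : Matrix ι ι ℂ} (h : M.trace = 1) :
    scaledSum f M = spectralSum f M := by
  simp [scaledSum, h]

/-- Superadditivity of the homogeneous extension of a concave trace function. -/
theorem sum_scaledSum_le {f : ℝ → ℝ} (hf : ConcaveOn ℝ (Set.Icc 0 1) f)
    {α : Type} [Fintype α] {M : α → Matrix ι ι ℂ} (hM : ∀ a, (M a).PosSemidef) :
    ∑ a, scaledSum f (M a) ≤ scaledSum f (∑ a, M a) := by
  classical
  have hT : (∑ a, M a).trace.re = ∑ a, (M a).trace.re := by rw [trace_sum, Complex.re_sum]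
  have hτ : ∀ a, 0 ≤ (M a).trace.re := fun a => trace_re_nonneg (hM a)
  have hsum : (∑ a, M a).PosSemidef := posSemidef_sum _ fun a _ => hM a
  by_cases h0 : (∑ a, M a).trace.re = 0
  · have hz : ∀ a, (M a).trace.re = 0 := fun a =>
      (Finset.sum_eq_zero_iff_of_nonneg fun a _ => hτ a).1 (hT ▸ h0) a (Finset.mem_univ a)
    simp [scaledSum, hz]
  · set T := (∑ a, M a).trace.re with hTdef
    have hTpos : 0 < T := lt_of_le_of_ne (trace_re_nonneg hsum) (Ne.symm h0)
    -- Terms of trace zero cannot be normalized to density matrices; being positive semidefinite,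
    -- they vanish and may be dropped.
    let s : Finset α := Finset.univ.filter fun a => (M a).trace.re ≠ 0
    have hs : ∀ a, a ∈ s ↔ (M a).trace.re ≠ 0 := fun a => by simp [s]
    have key := sum_mul_spectralSum_le hf s (p := fun a => (M a).trace.re / T)
      (fun a _ => div_nonneg (hτ a) hTpos.le)
      (by
        rw [← Finset.sum_div, Finset.sum_filter_ne_zero, ← hT, div_self h0])
      (B := fun a => (M a).trace.re⁻¹ • M a)
      (fun a _ => posSemidef_real_smul (hM a) (inv_nonneg.2 (hτ a)))
      (fun a ha => trace_normalized (hM a) ((hs a).1 ha))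
      (A := T⁻¹ • ∑ a, M a)
      (posSemidef_real_smul hsum (inv_nonneg.2 hTpos.le)).isHermitian
      (by
        rw [Finset.smul_sum]
        symm
        apply Finset.sum_subset_zero_on_sdiff (Finset.subset_univ s)
        · intro a ha
          have : (M a).trace.re = 0 := by simpa [hs] using ha
          rw [eq_zero_of_trace_re_eq_zero (hM a) this, smul_zero]
        · intro a ha
          rw [smul_smul, div_mul_eq_mul_div, mul_inv_cancel₀ ((hs a).1 ha), one_div])
    calc ∑ a, scaledSum f (M a) = ∑ a ∈ s, scaledSum f (M a) := by
          symm
          refine Finset.sum_subset (Finset.subset_univ s) fun a _ ha => ?_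
          have : (M a).trace.re = 0 := by simpa [hs] using ha
          rw [scaledSum, this, zero_mul]
      _ = T * ∑ a ∈ s, (M a).trace.re / T * spectralSum f ((M a).trace.re⁻¹ • M a) := by
          rw [Finset.mul_sum]
          refine Finset.sum_congr rfl fun a _ => ?_
          rw [scaledSum]
          field_simp
      _ ≤ scaledSum f (∑ a, M a) := mul_le_mul_of_nonneg_left key hTpos.le

theorem scaledSum_mul_conjTranspose_comm {f : ℝ → ℝ} (hf : f 0 = 0) (X : Matrix ι κ ℂ) :
    scaledSum f (X * Xᴴ) = scaledSum f (Xᴴ * X) := by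
  rw [scaledSum, scaledSum, spectralSum_mul_conjTranspose_comm hf, trace_mul_comm]

/-- Local operations on the left factor do not increase the value of a bipartite vector. -/
theorem sum_scaledSum_mul_left_le {f : ℝ → ℝ} (hf : ConcaveOn ℝ (Set.Icc 0 1) f) (h0 : f 0 = 0)
    {k : ℕ} {c : Fin k → ℕ} (K : ∀ i, Matrix (Fin (c i)) ι ℂ) (hK : ∑ i, (K i)ᴴ * K i = 1)
    (X : Matrix ι κ ℂ) :
    ∑ i, scaledSum f (K i * X * (K i * X)ᴴ) ≤ scaledSum f (X * Xᴴ) := by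
  -- In `X * Xᴴ` the `K i` stand outside; in `Xᴴ * X` they meet in the middle, where the
  -- completeness relation applies.
  simp only [scaledSum_mul_conjTranspose_comm h0]
  refine (sum_scaledSum_le hf fun i => posSemidef_conjTranspose_mul_self (K i * X)).trans_eq ?_
  congr 1
  calc ∑ i, (K i * X)ᴴ * (K i * X) = Xᴴ * (∑ i, (K i)ᴴ * K i) * X := by
        rw [Matrix.mul_sum, Matrix.sum_mul]
        refine Finset.sum_congr rfl fun i _ => ?_
        rw [conjTranspose_mul]
        simp only [Matrix.mul_assoc]
    _ = Xᴴ * X := by rw [hK, Matrix.mul_one]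

/-- Local operations on the right factor do not increase the value of a bipartite vector. -/
theorem sum_scaledSum_mul_right_le {f : ℝ → ℝ} (hf : ConcaveOn ℝ (Set.Icc 0 1) f)
    {k : ℕ} {c : Fin k → ℕ} (K : ∀ i, Matrix (Fin (c i)) κ ℂ) (hK : ∑ i, (K i)ᴴ * K i = 1)
    (X : Matrix ι κ ℂ) :
    ∑ i, scaledSum f (X * (K i)ᵀ * (X * (K i)ᵀ)ᴴ) ≤ scaledSum f (X * Xᴴ) := by
  refine (sum_scaledSum_le hf fun i => posSemidef_self_mul_conjTranspose (X * (K i)ᵀ)).trans_eq ?_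
  congr 1
  -- An operator `K` on the right factor acts on coefficient matrices as `X ↦ X * Kᵀ`, so
  -- completeness is needed in transposed form.
  have hK' : ∑ i, (K i)ᵀ * ((K i)ᵀ)ᴴ = 1 := by
    have := congrArg transpose hK
    rw [transpose_sum, transpose_one] at this
    rw [← this]
    refine Finset.sum_congr rfl fun i _ => ?_
    rw [transpose_mul]
    rfl
  calc ∑ i, X * (K i)ᵀ * (X * (K i)ᵀ)ᴴ = X * (∑ i, (K i)ᵀ * ((K i)ᵀ)ᴴ) * Xᴴ := by
        rw [Matrix.mul_sum, Matrix.sum_mul]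
        refine Finset.sum_congr rfl fun i _ => ?_
        rw [conjTranspose_mul]
        simp only [Matrix.mul_assoc]
    _ = X * Xᴴ := by rw [hK', Matrix.mul_one]

end ScaledSum

/-! ### Unnormalized ensembles and their evolution under LOCC. -/

section Ensembles

variable {m n : ℕ}

/-- The coordinates of a bipartite vector that is given by its coefficient matrix. -/
def coeffVec (X : Matrix (Fin m) (Fin n) ℂ) : Fin m × Fin n → ℂ := fun x => X x.1 x.2

/-- The rank one operator of a bipartite vector. -/
def outer (X : Matrix (Fin m) (Fin n) ℂ) : Matrix (Fin m × Fin n) (Fin m × Fin n) ℂ :=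
  vecMulVec (coeffVec X) (star (coeffVec X))

theorem posSemidef_outer (X : Matrix (Fin m) (Fin n) ℂ) : (outer X).PosSemidef :=
  posSemidef_vecMulVec_self_star _

theorem partialTraceB_outer (X : Matrix (Fin m) (Fin n) ℂ) :
    partialTraceB (outer X) = X * Xᴴ := by
  ext i k
  simp [partialTraceB, outer, vecMulVec_apply, coeffVec, mul_apply]

theorem mul_vecMulVec_mul_conjTranspose {ι κ : Type} [Fintype ι] (L : Matrix κ ι ℂ) (v : ι → ℂ) :
    L * vecMulVec v (star v) * Lᴴ = vecMulVec (L *ᵥ v) (star (L *ᵥ v)) := by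
  rw [mul_vecMulVec, vecMulVec_mul, star_mulVec]

theorem left_mulVec_coeffVec {c : ℕ} (K : Matrix (Fin c) (Fin m) ℂ)
    (X : Matrix (Fin m) (Fin n) ℂ) :
    (K ⊗ₖ (1 : Matrix (Fin n) (Fin n) ℂ)) *ᵥ coeffVec X = coeffVec (K * X) := by
  ext ⟨a, b⟩
  simp [mulVec, dotProduct, Fintype.sum_prod_type, coeffVec, mul_apply, one_apply]

theorem right_mulVec_coeffVec {c : ℕ} (K : Matrix (Fin c) (Fin n) ℂ)
    (X : Matrix (Fin m) (Fin n) ℂ) :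
    ((1 : Matrix (Fin m) (Fin m) ℂ) ⊗ₖ K) *ᵥ coeffVec X = coeffVec (X * Kᵀ) := by
  ext ⟨a, b⟩
  simp [mulVec, dotProduct, Fintype.sum_prod_type_right, coeffVec, mul_apply, one_apply, mul_comm]

theorem left_conj_outer {c : ℕ} (K : Matrix (Fin c) (Fin m) ℂ) (X : Matrix (Fin m) (Fin n) ℂ) :
    (K ⊗ₖ (1 : Matrix (Fin n) (Fin n) ℂ)) * outer X *
      (K ⊗ₖ (1 : Matrix (Fin n) (Fin n) ℂ))ᴴ = outer (K * X) := by
  rw [outer, mul_vecMulVec_mul_conjTranspose, left_mulVec_coeffVec, outer]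

theorem right_conj_outer {c : ℕ} (K : Matrix (Fin c) (Fin n) ℂ) (X : Matrix (Fin m) (Fin n) ℂ) :
    ((1 : Matrix (Fin m) (Fin m) ℂ) ⊗ₖ K) * outer X *
      ((1 : Matrix (Fin m) (Fin m) ℂ) ⊗ₖ K)ᴴ = outer (X * Kᵀ) := by
  rw [outer, mul_vecMulVec_mul_conjTranspose, right_mulVec_coeffVec, outer]

/-- The pairs of an unnormalized mixture of bipartite vectors and its total value. -/
def ensembles (f : ℝ → ℝ) (m n : ℕ) :
    AddSubmonoid (Matrix (Fin m × Fin n) (Fin m × Fin n) ℂ × ℝ) :=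
  AddSubmonoid.closure
    (Set.range fun X : Matrix (Fin m) (Fin n) ℂ => (outer X, scaledSum f (X * Xᴴ)))

theorem outer_mem_ensembles (f : ℝ → ℝ) (X : Matrix (Fin m) (Fin n) ℂ) :
    (outer X, scaledSum f (X * Xᴴ)) ∈ ensembles f m n :=
  AddSubmonoid.subset_closure ⟨X, rfl⟩

theorem ensembles_induction {f : ℝ → ℝ}
    {motive : Matrix (Fin m × Fin n) (Fin m × Fin n) ℂ → ℝ → Prop}
    (outer : ∀ X, motive (outer X) (scaledSum f (X * Xᴴ))) (zero : motive 0 0)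
    (add : ∀ M x N y, motive M x → motive N y → motive (M + N) (x + y))
    {M : Matrix (Fin m × Fin n) (Fin m × Fin n) ℂ} {x : ℝ} (h : (M, x) ∈ ensembles f m n) :
    motive M x := by
  refine AddSubmonoid.closure_induction (motive := fun z _ => motive z.1 z.2) ?_ zero ?_ h
  · rintro _ ⟨X, rfl⟩
    exact outer X
  · intro a b _ _ ha hb
    exact add _ _ _ _ ha hb

theorem posSemidef_of_mem_ensembles {f : ℝ → ℝ}
    {M : Matrix (Fin m × Fin n) (Fin m × Fin n) ℂ} {x : ℝ} (h : (M, x) ∈ ensembles f m n) :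
    M.PosSemidef :=
  ensembles_induction (motive := fun M _ => M.PosSemidef) posSemidef_outer PosSemidef.zero
    (fun _ _ _ _ h₁ h₂ => h₁.add h₂) h

theorem nonneg_of_mem_ensembles {f : ℝ → ℝ} (hf : ∀ x ∈ Set.Icc (0 : ℝ) 1, 0 ≤ f x)
    {M : Matrix (Fin m × Fin n) (Fin m × Fin n) ℂ} {x : ℝ} (h : (M, x) ∈ ensembles f m n) :
    0 ≤ x :=
  ensembles_induction (motive := fun _ x => 0 ≤ x)
    (fun X => scaledSum_nonneg hf (posSemidef_self_mul_conjTranspose X)) le_rfl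
    (fun _ _ _ _ h₁ h₂ => add_nonneg h₁ h₂) h

theorem outer_smul (c : ℝ) (X : Matrix (Fin m) (Fin n) ℂ) : outer (c • X) = c ^ 2 • outer X := by
  ext a b
  simp [outer, vecMulVec_apply, coeffVec]
  ring

theorem smul_mul_conjTranspose (c : ℝ) (X : Matrix (Fin m) (Fin n) ℂ) :
    (c • X) * (c • X)ᴴ = c ^ 2 • (X * Xᴴ) := by
  rw [conjTranspose_smul, star_trivial, smul_mul, Matrix.mul_smul, smul_smul, sq]

theorem smul_mem_ensembles {f : ℝ → ℝ} {c : ℝ} (hc : 0 ≤ c)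
    {M : Matrix (Fin m × Fin n) (Fin m × Fin n) ℂ} {x : ℝ} (h : (M, x) ∈ ensembles f m n) :
    (c • M, c * x) ∈ ensembles f m n := by
  refine ensembles_induction (motive := fun M x => (c • M, c * x) ∈ ensembles f m n)
    (fun X => ?_) ?_ (fun M x N y h₁ h₂ => ?_) h
  -- `outer` is quadratic, hence the square root.
  · have := outer_mem_ensembles f (√c • X)
    rwa [outer_smul, smul_mul_conjTranspose, scaledSum_smul, Real.sq_sqrt hc] at this
  · rw [smul_zero, mul_zero]
    exact zero_mem _
  · rw [smul_add, mul_add]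
    exact add_mem h₁ h₂

theorem sum_mem_ensembles {f : ℝ → ℝ} {α : Type} [Fintype α]
    {M : α → Matrix (Fin m × Fin n) (Fin m × Fin n) ℂ} {x : α → ℝ}
    (h : ∀ a, (M a, x a) ∈ ensembles f m n) : (∑ a, M a, ∑ a, x a) ∈ ensembles f m n := by
  have := sum_mem (t := Finset.univ) fun a _ => h a
  rwa [← Prod.mk.eta (p := ∑ a, _), Prod.fst_sum, Prod.snd_sum] at this

theorem left_operation_ensembles {f : ℝ → ℝ} (hf : ConcaveOn ℝ (Set.Icc 0 1) f) (h0 : f 0 = 0)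
    {k : ℕ} {c : Fin k → ℕ} (K : ∀ i, Matrix (Fin (c i)) (Fin m) ℂ)
    (hK : ∑ i, (K i)ᴴ * K i = 1)
    {M : Matrix (Fin m × Fin n) (Fin m × Fin n) ℂ} {x : ℝ} (h : (M, x) ∈ ensembles f m n) :
    ∃ y : Fin k → ℝ, (∀ i, ((K i ⊗ₖ (1 : Matrix (Fin n) (Fin n) ℂ)) * M *
      (K i ⊗ₖ (1 : Matrix (Fin n) (Fin n) ℂ))ᴴ, y i) ∈ ensembles f (c i) n) ∧ ∑ i, y i ≤ x := by
  refine ensembles_induction (motive := fun M x => ∃ y : Fin k → ℝ,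
    (∀ i, ((K i ⊗ₖ (1 : Matrix (Fin n) (Fin n) ℂ)) * M *
      (K i ⊗ₖ (1 : Matrix (Fin n) (Fin n) ℂ))ᴴ, y i) ∈ ensembles f (c i) n) ∧ ∑ i, y i ≤ x)
    (fun X => ?_) ?_ ?_ h
  · refine ⟨fun i => scaledSum f (K i * X * (K i * X)ᴴ), fun i => ?_,
      sum_scaledSum_mul_left_le hf h0 K hK X⟩
    rw [left_conj_outer]
    exact outer_mem_ensembles f _
  · refine ⟨0, fun i => ?_, by simp⟩
    rw [Matrix.mul_zero, Matrix.zero_mul]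
    exact zero_mem _
  · rintro M x N y ⟨u, hu, hux⟩ ⟨v, hv, hvy⟩
    refine ⟨u + v, fun i => ?_, ?_⟩
    · rw [Matrix.mul_add, Matrix.add_mul]
      exact add_mem (hu i) (hv i)
    · simpa [Finset.sum_add_distrib] using add_le_add hux hvy

theorem right_operation_ensembles {f : ℝ → ℝ} (hf : ConcaveOn ℝ (Set.Icc 0 1) f)
    {k : ℕ} {c : Fin k → ℕ} (K : ∀ i, Matrix (Fin (c i)) (Fin n) ℂ)
    (hK : ∑ i, (K i)ᴴ * K i = 1)
    {M : Matrix (Fin m × Fin n) (Fin m × Fin n) ℂ} {x : ℝ} (h : (M, x) ∈ ensembles f m n) :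
    ∃ y : Fin k → ℝ, (∀ i, (((1 : Matrix (Fin m) (Fin m) ℂ) ⊗ₖ K i) * M *
      ((1 : Matrix (Fin m) (Fin m) ℂ) ⊗ₖ K i)ᴴ, y i) ∈ ensembles f m (c i)) ∧ ∑ i, y i ≤ x := by
  refine ensembles_induction (motive := fun M x => ∃ y : Fin k → ℝ,
    (∀ i, (((1 : Matrix (Fin m) (Fin m) ℂ) ⊗ₖ K i) * M *
      ((1 : Matrix (Fin m) (Fin m) ℂ) ⊗ₖ K i)ᴴ, y i) ∈ ensembles f m (c i)) ∧ ∑ i, y i ≤ x)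
    (fun X => ?_) ?_ ?_ h
  · refine ⟨fun i => scaledSum f (X * (K i)ᵀ * (X * (K i)ᵀ)ᴴ), fun i => ?_,
      sum_scaledSum_mul_right_le hf K hK X⟩
    rw [right_conj_outer]
    exact outer_mem_ensembles f _
  · refine ⟨0, fun i => ?_, by simp⟩
    rw [Matrix.mul_zero, Matrix.zero_mul]
    exact zero_mem _
  · rintro M x N y ⟨u, hu, hux⟩ ⟨v, hv, hvy⟩
    refine ⟨u + v, fun i => ?_, ?_⟩
    · rw [Matrix.mul_add, Matrix.add_mul]
      exact add_mem (hu i) (hv i)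
    · simpa [Finset.sum_add_distrib] using add_le_add hux hvy

/-- The outcomes of a protocol have ensembles whose values do not exceed the initial one. -/
theorem LOCC.exists_ensembles {f : ℝ → ℝ} (hf : ConcaveOn ℝ (Set.Icc 0 1) f) (h0 : f 0 = 0)
    {J : Type} [Fintype J] [DecidableEq J] {m₁ n₁ m n : ℕ} (P : LOCC J m₁ n₁ m n)
    {M : Matrix (Fin m × Fin n) (Fin m × Fin n) ℂ} {x : ℝ} (h : (M, x) ∈ ensembles f m n) :
    ∃ y : J → ℝ, (∀ j, (P.branch j M, y j) ∈ ensembles f m₁ n₁) ∧ ∑ j, y j ≤ x := by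
  induction P generalizing x with
  | done l =>
    refine ⟨fun j => if l = j then x else 0, fun j => ?_, by simp⟩
    rw [LOCC.branch]
    dsimp only
    split_ifs
    · exact h
    · exact zero_mem _
  | alice c K hK next ih =>
    obtain ⟨u, hu, hux⟩ := left_operation_ensembles hf h0 K hK h
    choose v hv hvu using fun i => ih i (hu i)
    refine ⟨fun j => ∑ i, v i j, fun j => ?_, ?_⟩
    · rw [LOCC.branch]
      exact sum_mem_ensembles fun i => hv i j
    · rw [Finset.sum_comm]
      exact (Finset.sum_le_sum fun i _ => hvu i).trans hux
  | bob c K hK next ih =>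
    obtain ⟨u, hu, hux⟩ := right_operation_ensembles hf K hK h
    choose v hv hvu using fun i => ih i (hu i)
    refine ⟨fun j => ∑ i, v i j, fun j => ?_, ?_⟩
    · rw [LOCC.branch]
      exact sum_mem_ensembles fun i => hv i j
    · rw [Finset.sum_comm]
      exact (Finset.sum_le_sum fun i _ => hvu i).trans hux

end Ensembles

end TotalEntropy

namespace TotalEntropy

open Matrix

/-! ### The normalized binary entropy. -/

section EntropyFunction

theorem normFactor_pos {d : ℕ} (hd : 2 ≤ d) : 0 < normFactor d := by
  have hd' : (2 : ℝ) ≤ d := by exact_mod_cast hd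
  have h1 : Real.logb 2 ((d : ℝ) - 1) < Real.logb 2 d :=
    Real.logb_lt_logb (by norm_num) (by linarith) (by linarith)
  have h2 : 0 ≤ Real.logb 2 ((d : ℝ) - 1) := Real.logb_nonneg (by norm_num) (by linarith)
  rw [normFactor]
  nlinarith

/-- The normalized entropy function whose trace is the entropy entanglement. -/
def entropyFn (d : ℕ) (x : ℝ) : ℝ := 1 / normFactor d * (Real.binEntropy x / Real.log 2)

theorem entropyFn_zero (d : ℕ) : entropyFn d 0 = 0 := by simp [entropyFn]

theorem entropyFn_one (d : ℕ) : entropyFn d 1 = 0 := by simp [entropyFn]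

theorem entropyFn_coeff_pos {d : ℕ} (hd : 2 ≤ d) : 0 < 1 / normFactor d * (Real.log 2)⁻¹ :=
  mul_pos (one_div_pos.2 (normFactor_pos hd)) (inv_pos.2 (Real.log_pos (by norm_num)))

theorem entropyFn_eq (d : ℕ) (x : ℝ) :
    entropyFn d x = (1 / normFactor d * (Real.log 2)⁻¹) * Real.binEntropy x := by
  rw [entropyFn, div_eq_mul_inv]
  ring

theorem concaveOn_entropyFn {d : ℕ} (hd : 2 ≤ d) :
    ConcaveOn ℝ (Set.Icc 0 1) (entropyFn d) := by
  have := Real.strictConcave_binEntropy.concaveOn.smul (entropyFn_coeff_pos hd).le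
  refine this.congr fun x _ => ?_
  exact (entropyFn_eq d x).symm

/-- From `log y ≤ y - 1`, used at `x` and at `1 - x`. The quadratic lower bound replaces entropy by
a polynomial in the coefficients of the vector. -/
theorem mul_one_sub_le_binEntropy {x : ℝ} (hx : x ∈ Set.Icc (0 : ℝ) 1) :
    2 * (x * (1 - x)) ≤ Real.binEntropy x := by
  have key : ∀ {y : ℝ}, 0 ≤ y → y * (1 - y) ≤ y * Real.log y⁻¹ := fun {y} hy => by
    rcases hy.eq_or_lt with rfl | hy
    · simp
    · refine mul_le_mul_of_nonneg_left ?_ hy.le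
      rw [Real.log_inv]
      linarith [Real.log_le_sub_one_of_pos hy]
  have h1 := key hx.1
  have h2 := key (sub_nonneg.2 hx.2)
  rw [Real.binEntropy]
  linarith

theorem mul_one_sub_le_entropyFn {d : ℕ} (hd : 2 ≤ d) {x : ℝ} (hx : x ∈ Set.Icc (0 : ℝ) 1) :
    (1 / normFactor d * (Real.log 2)⁻¹ * 2) * (x * (1 - x)) ≤ entropyFn d x := by
  rw [entropyFn_eq, mul_assoc]
  exact mul_le_mul_of_nonneg_left (mul_one_sub_le_binEntropy hx) (entropyFn_coeff_pos hd).le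

theorem entropyFn_nonneg {d : ℕ} (hd : 2 ≤ d) {x : ℝ} (hx : x ∈ Set.Icc (0 : ℝ) 1) :
    0 ≤ entropyFn d x := by
  rw [entropyFn_eq]
  exact mul_nonneg (entropyFn_coeff_pos hd).le (Real.binEntropy_nonneg hx.1 hx.2)

end EntropyFunction

/-! ### The convex roof as an infimum over ensembles; (E2), (E3) and (E4). -/

section ConvexRoof

variable {m n : ℕ}

/-- The coefficient matrix of a bipartite vector. -/
def coeffMatrix (v : Fin m × Fin n → ℂ) : Matrix (Fin m) (Fin n) ℂ := of fun i j => v (i, j)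

theorem outer_coeffMatrix (v : Fin m × Fin n → ℂ) :
    outer (coeffMatrix v) = vecMulVec v (star v) := rfl

theorem trace_mul_conjTranspose (X : Matrix (Fin m) (Fin n) ℂ) :
    (X * Xᴴ).trace = ((∑ x, ‖coeffVec X x‖ ^ 2 : ℝ) : ℂ) := by
  simp [trace, mul_apply, coeffVec, Fintype.sum_prod_type, Complex.mul_conj']

theorem trace_outer (X : Matrix (Fin m) (Fin n) ℂ) : (outer X).trace = (X * Xᴴ).trace := by
  rw [trace_mul_conjTranspose, outer, trace_vecMulVec]
  simp [dotProduct, Complex.mul_conj']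

theorem trace_coeffMatrix (ψ : PureState m n) :
    (coeffMatrix ψ.1 * (coeffMatrix ψ.1)ᴴ).trace = 1 := by
  rw [trace_mul_conjTranspose]
  exact_mod_cast ψ.2

theorem pureEntanglement_eq (d : ℕ) (ψ : PureState m n) :
    pureEntanglement d ψ =
      spectralSum (entropyFn d) (coeffMatrix ψ.1 * (coeffMatrix ψ.1)ᴴ) := by
  have hH := isHermitian_mul_conjTranspose_self (coeffMatrix ψ.1)
  have h : partialTraceB ψ.proj = coeffMatrix ψ.1 * (coeffMatrix ψ.1)ᴴ := by
    rw [PureState.proj, ← outer_coeffMatrix, partialTraceB_outer]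
  rw [pureEntanglement, h, totalEntropy_eq_spectralSum hH, ← spectralSum_const_mul _ _ hH]
  rfl

theorem proj_mem_ensembles (d : ℕ) (ψ : PureState m n) :
    (ψ.proj, pureEntanglement d ψ) ∈ ensembles (entropyFn d) m n := by
  have := outer_mem_ensembles (entropyFn d) (coeffMatrix ψ.1)
  rwa [scaledSum_of_trace_eq_one _ (trace_coeffMatrix ψ), ← pureEntanglement_eq] at this

theorem exists_pureState_of_nonempty [Nonempty (Fin m × Fin n)] : Nonempty (PureState m n) :=
  ⟨⟨Pi.single (Classical.arbitrary _) 1, by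
    rw [Finset.sum_eq_single (Classical.arbitrary (Fin m × Fin n))]
    · simp
    · intro b _ hb
      simp [Pi.single_eq_of_ne hb]
    · simp⟩⟩

theorem exists_pureState_of_outer [Nonempty (Fin m × Fin n)] (d : ℕ)
    (X : Matrix (Fin m) (Fin n) ℂ) :
    ∃ ψ : PureState m n, outer X = (outer X).trace.re • ψ.proj ∧
      scaledSum (entropyFn d) (X * Xᴴ) = (outer X).trace.re * pureEntanglement d ψ := by
  by_cases h : (outer X).trace.re = 0
  -- The zero vector has weight zero, so any state serves.
  · obtain ⟨ψ⟩ := exists_pureState_of_nonempty (m := m) (n := n)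
    refine ⟨ψ, ?_, ?_⟩
    · rw [h, zero_smul, eq_zero_of_trace_re_eq_zero (posSemidef_outer X) h]
    · rw [scaledSum, ← trace_outer, h, zero_mul, zero_mul]
  · set t := (outer X).trace.re with ht
    have ht0 : 0 ≤ t := trace_re_nonneg (posSemidef_outer X)
    have hsq : (√t)⁻¹ ^ 2 = t⁻¹ := by rw [inv_pow, Real.sq_sqrt ht0]
    have hnorm : ∑ x, ‖coeffVec X x‖ ^ 2 = t := by
      rw [ht, trace_outer, trace_mul_conjTranspose, Complex.ofReal_re]
    have hunit : ∑ x, ‖coeffVec ((√t)⁻¹ • X) x‖ ^ 2 = 1 := by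
      calc ∑ x, ‖coeffVec ((√t)⁻¹ • X) x‖ ^ 2 = ∑ x, t⁻¹ * ‖coeffVec X x‖ ^ 2 := by
            refine Finset.sum_congr rfl fun x _ => ?_
            rw [← hsq, coeffVec, Matrix.smul_apply, norm_smul, mul_pow, Real.norm_eq_abs, sq_abs]
            rfl
        _ = 1 := by rw [← Finset.mul_sum, hnorm, inv_mul_cancel₀ h]
    let ψ : PureState m n := ⟨coeffVec ((√t)⁻¹ • X), hunit⟩
    have hproj : ψ.proj = outer ((√t)⁻¹ • X) := rfl
    have hcoeff : coeffMatrix ψ.1 = (√t)⁻¹ • X := rfl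
    refine ⟨ψ, ?_, ?_⟩
    · rw [hproj, outer_smul, hsq, smul_smul, mul_inv_cancel₀ h, one_smul]
    · rw [pureEntanglement_eq, hcoeff, smul_mul_conjTranspose, hsq, scaledSum, ← trace_outer]

theorem exists_sum_outer_of_mem_ensembles {f : ℝ → ℝ}
    {M : Matrix (Fin m × Fin n) (Fin m × Fin n) ℂ} {x : ℝ} (h : (M, x) ∈ ensembles f m n) :
    ∃ (k : ℕ) (X : Fin k → Matrix (Fin m) (Fin n) ℂ),
      M = ∑ i, outer (X i) ∧ x = ∑ i, scaledSum f (X i * (X i)ᴴ) := by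
  refine ensembles_induction (motive := fun M x =>
    ∃ (k : ℕ) (X : Fin k → Matrix (Fin m) (Fin n) ℂ),
      M = ∑ i, outer (X i) ∧ x = ∑ i, scaledSum f (X i * (X i)ᴴ))
    (fun X => ⟨1, fun _ => X, by simp, by simp⟩) ⟨0, Fin.elim0, by simp, by simp⟩ ?_ h
  rintro M x N y ⟨k, X, rfl, rfl⟩ ⟨l, Y, rfl, rfl⟩
  exact ⟨k + l, Fin.append X Y, by simp [Fin.sum_univ_add], by simp [Fin.sum_univ_add]⟩

theorem nonempty_of_trace_eq_one {ι : Type} [Fintype ι] {M : Matrix ι ι ℂ} (h : M.trace = 1) :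
    Nonempty ι := by
  by_contra hne
  rw [not_nonempty_iff] at hne
  simp [trace] at h

/-- The weights are the squared norms of the vectors; they sum to one because `ρ` has trace one. -/
theorem exists_decomposition_iff (d : ℕ) (ρ : BipartiteState m n) (x : ℝ) :
    (∃ (k : ℕ) (p : Fin k → ℝ) (ψ : Fin k → PureState m n),
      IsProb p ∧ ρ.1 = ∑ i, p i • (ψ i).proj ∧ x = ∑ i, p i * pureEntanglement d (ψ i)) ↔
    (ρ.1, x) ∈ ensembles (entropyFn d) m n := by
  constructor
  · rintro ⟨k, p, ψ, hp, hρ, rfl⟩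
    rw [hρ]
    exact sum_mem_ensembles fun i => smul_mem_ensembles (hp.1 i) (proj_mem_ensembles d (ψ i))
  · intro h
    obtain ⟨k, X, hX, hx⟩ := exists_sum_outer_of_mem_ensembles h
    have := nonempty_of_trace_eq_one ρ.2.2
    choose ψ hψ hval using fun i => exists_pureState_of_outer d (X i)
    refine ⟨k, fun i => (outer (X i)).trace.re, ψ,
      ⟨fun i => trace_re_nonneg (posSemidef_outer _), ?_⟩, ?_, ?_⟩
    · rw [← Complex.re_sum, ← trace_sum, ← hX, ρ.2.2, Complex.one_re]
    · rw [hX]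
      exact Finset.sum_congr rfl fun i _ => hψ i
    · rw [hx]
      exact Finset.sum_congr rfl fun i _ => hval i

theorem entanglement_eq_sInf (d : ℕ) (ρ : BipartiteState m n) :
    entanglement d m n ρ = sInf {x | (ρ.1, x) ∈ ensembles (entropyFn d) m n} := by
  rw [entanglement]
  congr 1
  ext x
  exact exists_decomposition_iff d ρ x

/-- Ensures that the infimum is over a nonempty set and so is not a default value. -/
theorem exists_mem_ensembles (f : ℝ → ℝ) {M : Matrix (Fin m × Fin n) (Fin m × Fin n) ℂ}
    (hM : M.PosSemidef) : ∃ x, (M, x) ∈ ensembles f m n := by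
  obtain ⟨k, v, hv⟩ := posSemidef_iff_eq_sum_vecMulVec.1 hM
  rw [hv]
  exact ⟨_, sum_mem_ensembles fun i => outer_mem_ensembles f (coeffMatrix (v i))⟩

theorem entanglement_le {d : ℕ} (hd : 2 ≤ d) {ρ : BipartiteState m n} {x : ℝ}
    (h : (ρ.1, x) ∈ ensembles (entropyFn d) m n) : entanglement d m n ρ ≤ x := by
  rw [entanglement_eq_sInf]
  exact csInf_le ⟨0, fun y hy => nonneg_of_mem_ensembles (fun _ => entropyFn_nonneg hd) hy⟩ h

theorem le_entanglement {d : ℕ} {ρ : BipartiteState m n} {b : ℝ}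
    (h : ∀ x, (ρ.1, x) ∈ ensembles (entropyFn d) m n → b ≤ x) : b ≤ entanglement d m n ρ := by
  rw [entanglement_eq_sInf]
  exact le_csInf (exists_mem_ensembles _ ρ.2.1) h

theorem exists_mem_ensembles_lt {d : ℕ} {ρ : BipartiteState m n} {b : ℝ}
    (h : entanglement d m n ρ < b) : ∃ x < b, (ρ.1, x) ∈ ensembles (entropyFn d) m n := by
  rw [entanglement_eq_sInf] at h
  obtain ⟨x, hx, hxb⟩ := exists_lt_of_csInf_lt (exists_mem_ensembles _ ρ.2.1) h
  exact ⟨x, hxb, hx⟩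

theorem entanglement_nonneg {d : ℕ} (hd : 2 ≤ d) (ρ : BipartiteState m n) :
    0 ≤ entanglement d m n ρ :=
  le_entanglement fun _ => nonneg_of_mem_ensembles fun _ => entropyFn_nonneg hd

theorem entanglement_convex {d : ℕ} (hd : 2 ≤ d) {k : ℕ} {p : Fin k → ℝ}
    {ρ : Fin k → BipartiteState m n} {σ : BipartiteState m n} (hp : IsProb p)
    (hσ : σ.1 = ∑ i, p i • (ρ i).1) :
    entanglement d m n σ ≤ ∑ i, p i * entanglement d m n (ρ i) := by
  refine le_of_forall_pos_le_add fun ε hε => ?_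
  choose x hx hmem using fun i => exists_mem_ensembles_lt
    (lt_add_of_pos_right (entanglement d m n (ρ i)) hε)
  have hσx : (σ.1, ∑ i, p i * x i) ∈ ensembles (entropyFn d) m n := by
    rw [hσ]
    exact sum_mem_ensembles fun i => smul_mem_ensembles (hp.1 i) (hmem i)
  calc entanglement d m n σ ≤ ∑ i, p i * x i := entanglement_le hd hσx
    _ ≤ ∑ i, p i * (entanglement d m n (ρ i) + ε) :=
        Finset.sum_le_sum fun i _ => mul_le_mul_of_nonneg_left (hx i).le (hp.1 i)
    _ = ∑ i, p i * entanglement d m n (ρ i) + ε := by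
        simp only [mul_add, Finset.sum_add_distrib, ← Finset.sum_mul, hp.2, one_mul]

theorem entanglement_locc {d : ℕ} (hd : 2 ≤ d) {m₁ n₁ q : ℕ} (P : LOCC (Fin q) m₁ n₁ m n)
    (ρ : BipartiteState m n) (p : Fin q → ℝ) (σ : Fin q → BipartiteState m₁ n₁)
    (hσ : ∀ j, P.branch j ρ.1 = p j • (σ j).1) :
    ∑ j, p j * entanglement d m₁ n₁ (σ j) ≤ entanglement d m n ρ := by
  refine le_entanglement fun x hx => ?_
  obtain ⟨y, hy, hyx⟩ := P.exists_ensembles (concaveOn_entropyFn hd) (entropyFn_zero d) hx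
  refine (Finset.sum_le_sum fun j _ => ?_).trans hyx
  have hj := hy j
  rw [hσ j] at hj
  -- Nonnegativity of `p j` is not assumed; it follows from the trace of a positive semidefinite
  -- branch.
  have hpj : 0 ≤ p j := by
    have := trace_re_nonneg (posSemidef_of_mem_ensembles hj)
    rwa [trace_smul, (σ j).2.2, Complex.real_smul, mul_one, Complex.ofReal_re] at this
  rcases hpj.eq_or_lt with h0 | hpos
  · rw [← h0, zero_mul]
    exact nonneg_of_mem_ensembles (fun _ => entropyFn_nonneg hd) hj
  · have h := smul_mem_ensembles (inv_nonneg.2 hpj) hj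
    rw [smul_smul, inv_mul_cancel₀ hpos.ne', one_smul] at h
    have := mul_le_mul_of_nonneg_left (entanglement_le hd h) hpj
    rwa [mul_inv_cancel_left₀ hpos.ne'] at this

theorem entanglement_le_of_local_unitary {d : ℕ} (hd : 2 ≤ d) (ρ σ : BipartiteState m n)
    {U : Matrix (Fin m) (Fin m) ℂ} (hU : U ∈ unitaryGroup (Fin m) ℂ)
    {V : Matrix (Fin n) (Fin n) ℂ} (hV : V ∈ unitaryGroup (Fin n) ℂ)
    (h : σ.1 = (U ⊗ₖ V) * ρ.1 * (Uᴴ ⊗ₖ Vᴴ)) :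
    entanglement d m n σ ≤ entanglement d m n ρ := by
  -- Two rounds with a single Kraus operator each.
  let P : LOCC (Fin 1) m n m n :=
    .alice (k := 1) (fun _ => m) (fun _ => U) (by simpa [star_eq_conjTranspose] using mem_unitaryGroup_iff'.1 hU) fun _ =>
      .bob (k := 1) (fun _ => n) (fun _ => V) (by simpa [star_eq_conjTranspose] using mem_unitaryGroup_iff'.1 hV) fun _ =>
        .done 0
  have key : ∀ j, P.branch j ρ.1 = (1 : ℝ) • σ.1 := fun j => by
    have h1 : ((1 : Matrix (Fin m) (Fin m) ℂ) ⊗ₖ V) * (U ⊗ₖ (1 : Matrix (Fin n) (Fin n) ℂ)) =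
        U ⊗ₖ V := by rw [← mul_kronecker_mul, Matrix.one_mul, Matrix.mul_one]
    have h2 : (U ⊗ₖ (1 : Matrix (Fin n) (Fin n) ℂ))ᴴ * ((1 : Matrix (Fin m) (Fin m) ℂ) ⊗ₖ V)ᴴ =
        Uᴴ ⊗ₖ Vᴴ := by rw [← conjTranspose_mul, h1, conjTranspose_kronecker]
    rw [one_smul, h, ← h1, ← h2]
    simp [P, LOCC.branch, Subsingleton.elim 0 j, Matrix.mul_assoc]
  simpa using entanglement_locc hd P ρ (fun _ => 1) (fun _ => σ) key

theorem entanglement_local_unitary {d : ℕ} (hd : 2 ≤ d) (ρ σ : BipartiteState m n)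
    {U : Matrix (Fin m) (Fin m) ℂ} (hU : U ∈ unitaryGroup (Fin m) ℂ)
    {V : Matrix (Fin n) (Fin n) ℂ} (hV : V ∈ unitaryGroup (Fin n) ℂ)
    (h : σ.1 = (U ⊗ₖ V) * ρ.1 * (Uᴴ ⊗ₖ Vᴴ)) :
    entanglement d m n σ = entanglement d m n ρ := by
  refine le_antisymm (entanglement_le_of_local_unitary hd ρ σ hU hV h)
    (entanglement_le_of_local_unitary hd σ ρ (Unitary.star_mem hU) (Unitary.star_mem hV) ?_)
  have hUV : (Uᴴ ⊗ₖ Vᴴ) * (U ⊗ₖ V) = 1 := by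
    rw [← mul_kronecker_mul, ← star_eq_conjTranspose, ← star_eq_conjTranspose,
      mem_unitaryGroup_iff'.1 hU, mem_unitaryGroup_iff'.1 hV, one_kronecker_one]
  simp only [star_eq_conjTranspose, conjTranspose_conjTranspose]
  rw [h]
  calc ρ.1 = ((Uᴴ ⊗ₖ Vᴴ) * (U ⊗ₖ V)) * ρ.1 * ((Uᴴ ⊗ₖ Vᴴ) * (U ⊗ₖ V)) := by
        rw [hUV, Matrix.one_mul, Matrix.mul_one]
    _ = _ := by simp only [Matrix.mul_assoc]

end ConvexRoof

end TotalEntropy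

/-! ### Compactness of convex hulls in finite dimension. -/

theorem sum_extend_zero {ι κ β : Type*} [Fintype ι] [Fintype κ] [AddCommMonoid β] (e : ι ↪ κ)
    (g : ι → β) : ∑ i, Function.extend e g 0 i = ∑ i, g i := by
  rw [← Finset.sum_subset (Finset.subset_univ (Finset.univ.map e))]
  · simp [e.injective.extend_apply]
  · intro i _ hi
    exact Function.extend_apply' _ _ _ (by simpa using hi)

/-- The convex hull of a compact set in finite dimension is compact. -/
theorem IsCompact.convexHull_of_finiteDimensional {E : Type*} [AddCommGroup E] [Module ℝ E]
    [TopologicalSpace E] [ContinuousAdd E] [ContinuousSMul ℝ E] [FiniteDimensional ℝ E]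
    {s : Set E} (hs : IsCompact s) : IsCompact (convexHull ℝ s) := by
  rcases s.eq_empty_or_nonempty with rfl | ⟨s₀, hs₀⟩
  · simp
  set N := Module.finrank ℝ E + 1 with hN
  let F : (Fin N → ℝ) × (Fin N → E) → E := fun q => ∑ i, q.1 i • q.2 i
  have hF : Continuous F := by fun_prop
  have hK : IsCompact (stdSimplex ℝ (Fin N) ×ˢ Set.univ.pi fun _ : Fin N => s) :=
    (isCompact_stdSimplex ℝ (Fin N)).prod (isCompact_univ_pi fun _ => hs)
  convert hK.image hF
  refine Set.Subset.antisymm (fun x hx => ?_) ?_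
  -- Carathéodory: affinely independent points number at most the dimension plus one. Shorter
  -- combinations are padded with weight `0` at `s₀`.
  · obtain ⟨ι, _, z, w, hz, hind, hw, hw1, hx⟩ := eq_pos_convex_span_of_mem_convexHull hx
    have hcard : Fintype.card ι ≤ N :=
      hind.card_le_finrank_succ.trans (Nat.succ_le_succ (Submodule.finrank_le _))
    obtain ⟨e⟩ : Nonempty (ι ↪ Fin N) :=
      Function.Embedding.nonempty_of_card_le (by simpa using hcard)
    refine ⟨(Function.extend e w 0, Function.extend e z fun _ => s₀), ⟨⟨fun i => ?_, ?_⟩,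
      fun i _ => ?_⟩, ?_⟩
    · by_cases hi : ∃ a, e a = i
      · obtain ⟨a, rfl⟩ := hi
        simpa [e.injective.extend_apply] using (hw a).le
      · simp [Function.extend_apply' _ _ _ hi]
    · rw [← hw1]
      exact sum_extend_zero e w
    · by_cases hi : ∃ a, e a = i
      · obtain ⟨a, rfl⟩ := hi
        simpa [e.injective.extend_apply] using hz ⟨a, rfl⟩
      · simpa [Function.extend_apply' _ _ _ hi] using hs₀
    · rw [← hx, ← sum_extend_zero e]
      refine Finset.sum_congr rfl fun i _ => ?_
      by_cases hi : ∃ a, e a = i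
      · obtain ⟨a, rfl⟩ := hi
        simp [e.injective.extend_apply]
      · simp [Function.extend_apply' _ _ _ hi]
  · rintro _ ⟨⟨w, z⟩, ⟨hw, hz⟩, rfl⟩
    exact (convex_convexHull ℝ s).sum_mem (fun i _ => hw.1 i) hw.2
      fun i hi => subset_convexHull ℝ s (hz i (Set.mem_univ i))

namespace TotalEntropy

open Matrix

/-! ### Faithfulness (E1). -/

section Separability

variable {m n : ℕ}

/-- Once normalized, a nonzero rank one operator is a projection, with eigenvalues `0` and `1` only.
-/
theorem scaledSum_vecMulVec_self_star {f : ℝ → ℝ} (h0 : f 0 = 0) (h1 : f 1 = 0) (a : Fin m → ℂ) :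
    scaledSum f (vecMulVec a (star a)) = 0 := by
  set A := vecMulVec a (star a) with hA
  have hpos : A.PosSemidef := posSemidef_vecMulVec_self_star a
  have hsq : A * A = A.trace • A := by
    rw [hA, vecMulVec_mul_vecMulVec, trace_vecMulVec, vecMulVec_smul, dotProduct_comm]
  by_cases h : A.trace.re = 0
  · rw [scaledSum, h, zero_mul]
  · rw [scaledSum, spectralSum_eq_zero_of_idempotent h0 h1
      (posSemidef_real_smul hpos (inv_nonneg.2 (trace_re_nonneg hpos))).isHermitian, mul_zero]
    rw [IsIdempotentElem, smul_mul_smul_comm, hsq, ← ofReal_trace_re hpos, Complex.coe_smul,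
      smul_smul, mul_assoc, Complex.ofReal_re, inv_mul_cancel₀ h, mul_one]

theorem outer_vecMulVec (a : Fin m → ℂ) (b : Fin n → ℂ) :
    outer (vecMulVec a b) = vecMulVec a (star a) ⊗ₖ vecMulVec b (star b) := by
  ext x y
  simp [outer, vecMulVec_apply, coeffVec]
  ring

theorem product_mem_ensembles {f : ℝ → ℝ} (h0 : f 0 = 0) (h1 : f 1 = 0) (a : Fin m → ℂ)
    (b : Fin n → ℂ) :
    (vecMulVec a (star a) ⊗ₖ vecMulVec b (star b), (0 : ℝ)) ∈ ensembles f m n := by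
  have h : vecMulVec a b * (vecMulVec a b)ᴴ = (∑ j, ‖b j‖ ^ 2) • vecMulVec a (star a) := by
    ext i k
    rw [Matrix.smul_apply, Complex.real_smul, mul_apply]
    push_cast
    rw [Finset.sum_mul]
    refine Finset.sum_congr rfl fun j _ => ?_
    rw [← Complex.mul_conj']
    simp [vecMulVec_apply]
    ring
  have := outer_mem_ensembles f (vecMulVec a b)
  rwa [outer_vecMulVec, h, scaledSum_smul, scaledSum_vecMulVec_self_star h0 h1, mul_zero] at this

theorem kronecker_mem_ensembles {f : ℝ → ℝ} (h0 : f 0 = 0) (h1 : f 1 = 0)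
    {α : Matrix (Fin m) (Fin m) ℂ} {β : Matrix (Fin n) (Fin n) ℂ} (hα : α.PosSemidef)
    (hβ : β.PosSemidef) : (α ⊗ₖ β, (0 : ℝ)) ∈ ensembles f m n := by
  obtain ⟨k, a, rfl⟩ := posSemidef_iff_eq_sum_vecMulVec.1 hα
  obtain ⟨l, b, rfl⟩ := posSemidef_iff_eq_sum_vecMulVec.1 hβ
  have h := sum_mem_ensembles fun i => sum_mem_ensembles fun j =>
    product_mem_ensembles h0 h1 (a i) (b j)
  have e : (∑ i, vecMulVec (a i) (star (a i))) ⊗ₖ (∑ j, vecMulVec (b j) (star (b j))) =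
      ∑ i, ∑ j, vecMulVec (a i) (star (a i)) ⊗ₖ vecMulVec (b j) (star (b j)) := by
    ext x y
    simp only [kroneckerMap_apply, Matrix.sum_apply, Finset.sum_mul_sum]
  rw [e]
  simpa using h

theorem entanglement_eq_zero_of_isSeparable {d : ℕ} (hd : 2 ≤ d) {ρ : BipartiteState m n}
    (h : IsSeparable ρ) : entanglement d m n ρ = 0 := by
  obtain ⟨k, p, α, β, hp, hρ⟩ := h
  refine le_antisymm (entanglement_le hd ?_) (entanglement_nonneg hd ρ)
  have := sum_mem_ensembles fun i => smul_mem_ensembles (hp.1 i)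
    (kronecker_mem_ensembles (entropyFn_zero d) (entropyFn_one d) (α i).2.1 (β i).2.1)
  rw [hρ]
  simpa using this

/-- The sum of the squared absolute values of the `2 × 2` minors of the coefficient matrix. -/
def minorDefect (v : Fin m × Fin n → ℂ) : ℝ :=
  ∑ i, ∑ k, ∑ j, ∑ l, ‖v (i, j) * v (k, l) - v (i, l) * v (k, j)‖ ^ 2

theorem minorDefect_nonneg (v : Fin m × Fin n → ℂ) : 0 ≤ minorDefect v := by
  unfold minorDefect
  positivity

/-- Lagrange's identity: in the expanded squares the diagonal terms sum to the squared trace and the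
cross terms to the purity, each twice by the symmetry `j ↔ l`. For unit vectors this is twice the
linear entropy. -/
theorem minorDefect_eq (X : Matrix (Fin m) (Fin n) ℂ) :
    (minorDefect (coeffVec X) : ℂ) =
      2 * ((X * Xᴴ).trace ^ 2 - ((X * Xᴴ) * (X * Xᴴ)).trace) := by
  set s : Fin m → Fin m → Fin n → Fin n → ℂ :=
    fun i k j l => X i j * star (X i j) * (X k l * star (X k l)) with hs
  set t : Fin m → Fin m → Fin n → Fin n → ℂ :=
    fun i k j l => X i j * star (X k j) * (X k l * star (X i l)) with ht
  have hS : ∑ i, ∑ k, ∑ j, ∑ l, s i k j l = (X * Xᴴ).trace ^ 2 := by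
    simp only [hs, sq, trace, diag_apply, mul_apply, conjTranspose_apply, Finset.sum_mul_sum]
  have hT : ∑ i, ∑ k, ∑ j, ∑ l, t i k j l = ((X * Xᴴ) * (X * Xᴴ)).trace := by
    simp only [ht, trace, diag_apply, mul_apply, conjTranspose_apply, Finset.sum_mul_sum]
  have swap : ∀ g : Fin m → Fin m → Fin n → Fin n → ℂ,
      ∑ i, ∑ k, ∑ j, ∑ l, g i k l j = ∑ i, ∑ k, ∑ j, ∑ l, g i k j l := fun g =>
    Finset.sum_congr rfl fun i _ => Finset.sum_congr rfl fun k _ => Finset.sum_comm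
  calc (minorDefect (coeffVec X) : ℂ)
      = ∑ i, ∑ k, ∑ j, ∑ l, ((s i k j l + s i k l j) - (t i k j l + t i k l j)) := by
        unfold minorDefect
        push_cast
        refine Finset.sum_congr rfl fun i _ => Finset.sum_congr rfl fun k _ =>
          Finset.sum_congr rfl fun j _ => Finset.sum_congr rfl fun l _ => ?_
        rw [← Complex.mul_conj']
        simp only [coeffVec, hs, ht, map_sub, map_mul, RCLike.star_def]
        ring
    _ = _ := by
        simp only [Finset.sum_sub_distrib, Finset.sum_add_distrib]
        rw [swap s, swap t, hS, hT]
        ring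

theorem minorDefect_le_pureEntanglement {d : ℕ} (hd : 2 ≤ d) (ψ : PureState m n) :
    (1 / normFactor d * (Real.log 2)⁻¹) * minorDefect ψ.1 ≤ pureEntanglement d ψ := by
  set X := coeffMatrix ψ.1 with hX
  have hH := isHermitian_mul_conjTranspose_self X
  have htr : (X * Xᴴ).trace = 1 := trace_coeffMatrix ψ
  have hdef : minorDefect ψ.1 = 2 * (trace (X * Xᴴ * (1 - X * Xᴴ))).re := by
    have h := minorDefect_eq X
    rw [htr] at h
    rw [Matrix.mul_sub, Matrix.mul_one, trace_sub, htr]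
    have h' := congrArg Complex.re h
    rw [Complex.ofReal_re] at h'
    rw [show minorDefect ψ.1 = minorDefect (coeffVec X) from rfl, h']
    simp
  have h := spectralSum_mono (fun x => mul_one_sub_le_entropyFn hd)
    (posSemidef_self_mul_conjTranspose X) htr
  rw [spectralSum_const_mul _ (fun x => x * (1 - x)) hH, spectralSum_mul_one_sub hH] at h
  rw [pureEntanglement_eq, hdef, ← mul_assoc]
  exact h

theorem exists_product_of_minorDefect_eq_zero {v : Fin m × Fin n → ℂ} (hv : minorDefect v = 0)
    (h0 : v ≠ 0) : ∃ (a : Fin m → ℂ) (b : Fin n → ℂ), ∀ i j, v (i, j) = a i * b j := by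
  obtain ⟨⟨i₀, j₀⟩, hne⟩ := Function.ne_iff.1 h0
  have hminor : ∀ i k j l, v (i, j) * v (k, l) - v (i, l) * v (k, j) = 0 := fun i k j l => by
    unfold minorDefect at hv
    rw [Finset.sum_eq_zero_iff_of_nonneg fun _ _ => by positivity] at hv
    have hv := hv i (Finset.mem_univ _)
    rw [Finset.sum_eq_zero_iff_of_nonneg fun _ _ => by positivity] at hv
    have hv := hv k (Finset.mem_univ _)
    rw [Finset.sum_eq_zero_iff_of_nonneg fun _ _ => by positivity] at hv
    have hv := hv j (Finset.mem_univ _)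
    rw [Finset.sum_eq_zero_iff_of_nonneg fun _ _ => by positivity] at hv
    simpa using hv l (Finset.mem_univ _)
  -- Column and row through a nonzero pivot; the minors containing the pivot give the factorization.
  refine ⟨fun i => v (i, j₀), fun j => v (i₀, j) / v (i₀, j₀), fun i j => ?_⟩
  have hne' : v (i₀, j₀) ≠ 0 := hne
  rw [← mul_div_assoc, eq_div_iff hne']
  linear_combination hminor i i₀ j j₀

theorem exists_product_states_of_minorDefect_eq_zero (ψ : PureState m n)
    (h : minorDefect ψ.1 = 0) :
    ∃ (α : DensityMatrix (Fin m)) (β : DensityMatrix (Fin n)), ψ.proj = α.1 ⊗ₖ β.1 := by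
  have h0 : ψ.1 ≠ 0 := fun h0 => by
    have := ψ.2
    simp [h0] at this
  obtain ⟨a, b, hab⟩ := exists_product_of_minorDefect_eq_zero h h0
  have hnorm : (∑ i, ‖a i‖ ^ 2) * ∑ j, ‖b j‖ ^ 2 = 1 := by
    rw [← ψ.2, Fintype.sum_prod_type, Finset.sum_mul_sum]
    simp only [hab, norm_mul, mul_pow]
  have htr : ∀ {k : ℕ} (c : Fin k → ℂ), (vecMulVec c (star c)).trace = ((∑ i, ‖c i‖ ^ 2 : ℝ) : ℂ) :=
    fun c => by simp [trace_vecMulVec, dotProduct, Complex.mul_conj']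
  set r := ∑ i, ‖a i‖ ^ 2 with hr
  set s := ∑ j, ‖b j‖ ^ 2 with hs
  have hr0 : 0 ≤ r := Finset.sum_nonneg fun _ _ => sq_nonneg _
  have hs0 : 0 ≤ s := Finset.sum_nonneg fun _ _ => sq_nonneg _
  -- Only the product `r * s` is known to be `1`, so each factor is normalized by the squared norm
  -- of the other.
  refine ⟨⟨s • vecMulVec a (star a), posSemidef_real_smul (posSemidef_vecMulVec_self_star a) hs0,
    ?_⟩, ⟨r • vecMulVec b (star b), posSemidef_real_smul (posSemidef_vecMulVec_self_star b) hr0,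
    ?_⟩, ?_⟩
  · rw [trace_smul, htr, Complex.real_smul, ← Complex.ofReal_mul, mul_comm, hnorm,
      Complex.ofReal_one]
  · rw [trace_smul, htr, Complex.real_smul, ← Complex.ofReal_mul, hnorm, Complex.ofReal_one]
  · have hψ : ψ.1 = coeffVec (vecMulVec a b) := funext fun x => hab x.1 x.2
    rw [smul_kronecker, kronecker_smul, smul_smul, mul_comm s r, hnorm, one_smul,
      ← outer_vecMulVec, PureState.proj, hψ, outer]

/-- The graph of `minorDefect` on the pure states. -/
def defectGraph (m n : ℕ) : Set (Matrix (Fin m × Fin n) (Fin m × Fin n) ℂ × ℝ) :=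
  Set.range fun ψ : PureState m n => (ψ.proj, minorDefect ψ.1)

theorem isCompact_defectGraph : IsCompact (defectGraph m n) := by
  have hS : IsCompact {v : Fin m × Fin n → ℂ | ∑ x, ‖v x‖ ^ 2 = 1} := by
    refine Metric.isCompact_of_isClosed_isBounded (isClosed_eq (by fun_prop) continuous_const) ?_
    refine (Metric.isBounded_closedBall (x := (0 : Fin m × Fin n → ℂ)) (r := 1)).subset ?_
    intro v hv
    rw [mem_closedBall_zero_iff, pi_norm_le_iff_of_nonneg zero_le_one]
    intro x
    have hx : ‖v x‖ ^ 2 ≤ 1 := by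
      rw [← show ∑ x, ‖v x‖ ^ 2 = 1 from hv]
      exact Finset.single_le_sum (f := fun x => ‖v x‖ ^ 2) (fun _ _ => sq_nonneg _)
        (Finset.mem_univ x)
    exact (sq_le_one_iff₀ (norm_nonneg _)).1 hx
  have hF : Continuous fun v : Fin m × Fin n → ℂ => (vecMulVec v (star v), minorDefect v) := by
    unfold minorDefect
    exact (continuous_id.matrix_vecMulVec continuous_star).prodMk (by fun_prop)
  convert hS.image hF
  ext z
  constructor
  · rintro ⟨ψ, rfl⟩
    exact ⟨ψ.1, ψ.2, rfl⟩
  · rintro ⟨v, hv, rfl⟩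
    exact ⟨⟨v, hv⟩, rfl⟩

/-- Decompositions of entanglement below `c * ε` have mean defect below `ε`. The mean defects over
`ρ` form a closed set, so `0` belongs to it. -/
theorem mem_convexHull_defectGraph_of_entanglement_eq_zero {d : ℕ} (hd : 2 ≤ d)
    {ρ : BipartiteState m n} (h : entanglement d m n ρ = 0) :
    (ρ.1, (0 : ℝ)) ∈ convexHull ℝ (defectGraph m n) := by
  set c := 1 / normFactor d * (Real.log 2)⁻¹ with hc
  have hcpos : 0 < c := entropyFn_coeff_pos hd
  have hclosed : IsClosed {y : ℝ | (ρ.1, y) ∈ convexHull ℝ (defectGraph m n)} :=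
    isCompact_defectGraph.convexHull_of_finiteDimensional.isClosed.preimage
      (Continuous.prodMk_right ρ.1)
  refine hclosed.closure_subset (Metric.mem_closure_iff.2 fun ε hε => ?_)
  obtain ⟨x, hx, hmem⟩ := exists_mem_ensembles_lt (ρ := ρ) (h.trans_lt (mul_pos hcpos hε))
  obtain ⟨k, p, ψ, hp, hρ, rfl⟩ := (exists_decomposition_iff d ρ x).2 hmem
  have hnn : 0 ≤ ∑ i, p i * minorDefect (ψ i).1 :=
    Finset.sum_nonneg fun i _ => mul_nonneg (hp.1 i) (minorDefect_nonneg _)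
  refine ⟨∑ i, p i * minorDefect (ψ i).1, ?_, ?_⟩
  · have := (convex_convexHull ℝ (defectGraph m n)).sum_mem (t := Finset.univ)
      (fun i _ => hp.1 i) hp.2 fun i _ => subset_convexHull ℝ _ ⟨ψ i, rfl⟩
    rw [Set.mem_ofPred_eq, hρ]
    rwa [← Prod.mk.eta (p := ∑ i, _), Prod.fst_sum, Prod.snd_sum] at this
  · rw [dist_zero_left, Real.norm_eq_abs, abs_of_nonneg hnn]
    refine lt_of_mul_lt_mul_left (lt_of_le_of_lt ?_ hx) hcpos.le
    rw [Finset.mul_sum]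
    refine Finset.sum_le_sum fun i _ => ?_
    rw [mul_left_comm]
    exact mul_le_mul_of_nonneg_left (minorDefect_le_pureEntanglement hd (ψ i)) (hp.1 i)

/-- With strictly positive weights, a zero mean of nonnegative defects forces each defect to vanish.
-/
theorem isSeparable_of_mem_convexHull_defectGraph {ρ : BipartiteState m n}
    (h : (ρ.1, (0 : ℝ)) ∈ convexHull ℝ (defectGraph m n)) : IsSeparable ρ := by
  obtain ⟨ι, _, z, w, hz, -, hw, hw1, hsum⟩ := eq_pos_convex_span_of_mem_convexHull h
  choose ψ hψ using fun i => hz ⟨i, rfl⟩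
  have hfst : ρ.1 = ∑ i, w i • (ψ i).proj := by
    have := congrArg Prod.fst hsum
    rw [Prod.fst_sum] at this
    simpa [← hψ] using this.symm
  have hsnd : ∑ i, w i * minorDefect (ψ i).1 = 0 := by
    have := congrArg Prod.snd hsum
    rw [Prod.snd_sum] at this
    simpa [← hψ] using this
  have hzero : ∀ i, minorDefect (ψ i).1 = 0 := fun i => by
    rw [Finset.sum_eq_zero_iff_of_nonneg fun i _ =>
      mul_nonneg (hw i).le (minorDefect_nonneg _)] at hsnd
    exact (mul_eq_zero.1 (hsnd i (Finset.mem_univ i))).resolve_left (hw i).ne'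
  choose α β hαβ using fun i => exists_product_states_of_minorDefect_eq_zero (ψ i) (hzero i)
  let e := Fintype.equivFin ι
  refine ⟨Fintype.card ι, w ∘ e.symm, α ∘ e.symm, β ∘ e.symm, ⟨fun i => (hw _).le, ?_⟩, ?_⟩
  · rw [← hw1]
    exact e.symm.sum_comp w
  · rw [hfst, ← e.symm.sum_comp]
    exact Finset.sum_congr rfl fun i _ => by rw [hαβ]; rfl

theorem entanglement_eq_zero_iff {d : ℕ} (hd : 2 ≤ d) (ρ : BipartiteState m n) :
    entanglement d m n ρ = 0 ↔ IsSeparable ρ :=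
  ⟨fun h => isSeparable_of_mem_convexHull_defectGraph
    (mem_convexHull_defectGraph_of_entanglement_eq_zero hd h),
    entanglement_eq_zero_of_isSeparable hd⟩

end Separability

end TotalEntropy

end

theorem theorem1 (d : ℕ) (hd : 2 ≤ d) :
    TotalEntropy.IsEntanglementMeasure (TotalEntropy.entanglement d) where
  nonneg _ _ ρ := TotalEntropy.entanglement_nonneg hd ρ
  eq_zero_iff _ _ ρ := TotalEntropy.entanglement_eq_zero_iff hd ρ
  local_unitary _ _ ρ σ _ hU _ hV h := TotalEntropy.entanglement_local_unitary hd ρ σ hU hV h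
  locc _ _ _ _ _ P ρ p σ h := TotalEntropy.entanglement_locc hd P ρ p σ h
  convex _ _ _ _ _ _ hp h := TotalEntropy.entanglement_convex hd hp h
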